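/- Let $K$ be a field of characteristic $0$ (for instance $\mathbb C$), let $d$ be odd and $N\ge 0$, and let $R=K[t_1,\dots,t_N,u_1,\dots,u_N,v_1,\dots,v_N,\dots]$ be the polynomial ring in $dN$ variables, one group of $N$ variables for each of the $d$ coordinate directions; the index $i=1,\dots,N$ labels the particles, and the grade of a polynomial is its total degree. Let $S\subset R$ be the subalgebra of the polynomials that are symmetric in each of the $d$ groups of variables separately, $S_+\subset S$ the ideal of those with zero constant term, and $A\subset R$ the $S$-module of the diagonally antisymmetric polynomials, i.e. those that are multiplied by $\operatorname{sgn}\sigma$ when the particle labels are permuted by $\sigma$ in all groups simultaneously. A system of shapes is a basis of the $S$-module $A$ that consists of homogeneous polynomials; its members are called shapes. Let $$\Delta=\Delta_N(t)\,\Delta_N(u)\,\Delta_N(v)\cdots$$ be the product over the $d$ directions of the Vandermonde determinants. Then finite systems of shapes exist, so $A$ is a free $S$-module. Every system of shapes has exactly one member $\Psi$ of grade $dN(N-1)/2$, and all its other members have strictly smaller grade. This highest-graded shape is the product of Vandermonde determinants, up to a nonzero scalar factor and excitations of shapes: there is $c\in K\setminus\{0\}$ with $\Psi-c\,\Delta\in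 S_+A$. Moreover, replacing $\Psi$ by $\Delta$ and keeping all the other members gives again a system of shapes. -/

import Mathlib

open MvPolynomial

namespace FermionShapes

/-- Formal-power wave functions of `N` particles in `d` dimensions: polynomials in the variables
`X (a, i)`, the `a`-th Cartesian coordinate of the `i`-th particle. A single-particle state is
represented by a monomial, and the grade (number of nodes) is the degree. -/
abbrev Wave (K : Type*) [Field K] (d N : ℕ) : Type _ := MvPolynomial (Fin d × Fin N) K

/-- Permute the `a`-th coordinates of the particles, leaving all the other coordinates alone. -/
def permCoord {d N : ℕ} (a : Fin d) (σ : Equiv.Perm (Fin N)) (x : Fin d × Fin N) :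
    Fin d × Fin N :=
  (x.1, if x.1 = a then σ x.2 else x.2)

/-- Permute the particles, that is, the vector coordinates `r_i`. -/
def permParticle {d N : ℕ} (σ : Equiv.Perm (Fin N)) (x : Fin d × Fin N) : Fin d × Fin N :=
  (x.1, σ x.2)

/-- The algebra of polynomials symmetric in each coordinate direction separately. -/
def sepSymm (K : Type*) [Field K] (d N : ℕ) : Subalgebra K (Wave K d N) where
  carrier := {p | ∀ (a : Fin d) (σ : Equiv.Perm (Fin N)), rename (permCoord a σ) p = p}
  mul_mem' hp hq a σ := by rw [map_mul, hp a σ, hq a σ]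
  add_mem' hp hq a σ := by rw [map_add, hp a σ, hq a σ]
  algebraMap_mem' r a σ := (rename (permCoord a σ)).commutes r

theorem rename_permParticle_of_mem {K : Type*} [Field K] {d N : ℕ} {p : Wave K d N}
    (hp : p ∈ sepSymm K d N) (σ : Equiv.Perm (Fin N)) : rename (permParticle σ) p = p := by
  classical
  have key : ∀ s : Finset (Fin d),
      rename (fun x : Fin d × Fin N => (x.1, if x.1 ∈ s then σ x.2 else x.2)) p = p := by
    intro s
    induction s using Finset.induction_on with
    | empty =>
      have h : (fun x : Fin d × Fin N => (x.1, if x.1 ∈ (∅ : Finset (Fin d)) then σ x.2 else x.2))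
          = id := by
        funext x
        simp
      rw [h, rename_id_apply]
    | insert a s ha ih =>
      have h : (fun x : Fin d × Fin N => (x.1, if x.1 ∈ insert a s then σ x.2 else x.2))
          = permCoord a σ ∘
            (fun x : Fin d × Fin N => (x.1, if x.1 ∈ s then σ x.2 else x.2)) := by
        funext x
        by_cases hx : x.1 = a
        · simp [permCoord, hx, ha]
        · simp [permCoord, hx]
      rw [h, ← rename_rename, ih]
      exact hp a σ
  have h := key Finset.univ
  simp only [Finset.mem_univ, if_true] at h
  exact h

/-- The module, over the polynomials symmetric in each direction separately, of the polynomials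
that are antisymmetric under permutations of the particles (diagonally antisymmetric). -/
def antisymm (K : Type*) [Field K] (d N : ℕ) : Submodule (sepSymm K d N) (Wave K d N) where
  carrier := {p | ∀ σ : Equiv.Perm (Fin N),
    rename (permParticle σ) p = C ((Equiv.Perm.sign σ : ℤ) : K) * p}
  add_mem' hp hq σ := by rw [map_add, hp σ, hq σ, mul_add]
  zero_mem' σ := by rw [map_zero, mul_zero]
  smul_mem' c p hp σ := by
    rw [Algebra.smul_def, map_mul, hp σ]
    change rename (permParticle σ) (c : Wave K d N) * _ = _ * ((c : Wave K d N) * p)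
    rw [rename_permParticle_of_mem c.2 σ, mul_left_comm]

/-- A system of shapes: a basis, consisting of homogeneous polynomials, of the module of
diagonally antisymmetric polynomials over the polynomials symmetric in each direction. -/
def IsShapeSystem {K : Type*} [Field K] {d N : ℕ} {ι : Type*}
    (Ψ : Module.Basis ι (sepSymm K d N) (antisymm K d N)) : Prop :=
  ∀ i, ∃ n : ℕ, (Ψ i : Wave K d N).IsHomogeneous n

/-- The elements of `sepSymm K d N` with zero constant term. -/
noncomputable def sepSymmPos (K : Type*) [Field K] (d N : ℕ) : Ideal (sepSymm K d N) :=
  RingHom.ker ((constantCoeff (R := K) (σ := Fin d × Fin N)).comp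
    (sepSymm K d N).val.toRingHom)

/-- The finite sums of products `Φ * Ψ` with `Ψ` diagonally antisymmetric and `Φ` symmetric in
each direction and without constant term. -/
noncomputable def excitations (K : Type*) [Field K] (d N : ℕ) : Submodule (sepSymm K d N) (Wave K d N) :=
  sepSymmPos K d N • antisymm K d N

/-- The product over the dimensions of the Vandermonde determinants. -/
noncomputable def vandermondeProd (K : Type*) [Field K] (d N : ℕ) : Wave K d N :=
  ∏ a : Fin d, (Matrix.vandermonde fun i : Fin N => (X (a, i) : Wave K d N)).det

end FermionShapes

/-! Let `G` be the group of separate permutations in the `d` directions, `J = S₊R` the coinvariant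
ideal (`coinvIdeal`) and `D = dN(N-1)/2`. The staircase monomials, in which particle `i` (counted
from 0) has exponent at most `i` in every direction, span `R` over `S` (`span_stairMonomial`). Hence
`R/J` vanishes above degree `D`, and in degree `D` it is spanned by a single monomial. The
Vandermonde product is nonzero there: alternation over `G` is `S`-linear with values of order at
least `D`, so it sends `J` to order greater than `D`, yet it multiplies `Δ` by `|G|`
(`vandermondeProd_notMem_coinvIdeal`). So `Δ` spans the top degree of `R/J`.

The antisymmetrizer is an `S`-linear graded projection onto `A`, whence `S₊A = J ∩ A`
(`mem_excitations_iff`). It splits `R/J`, so a basis of `R/J` lifts to homogeneous elements each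
lying in `A` or in its kernel. By graded Nakayama they generate `R`; there are at most `|G|` of
them, so they are independent by Dedekind's lemma (`linearIndependent_of_span_eq_top`). Those in `A`
form a basis of `A`.

In any system of shapes no member lies in `J`, so all grades are at most `D`, and two members of
grade `D` would be proportional modulo `J`. Conversely `Δ ∉ J` has a coordinate outside `S₊`; by
homogeneity it is a nonzero constant at a member of grade `D`, and an exchange puts `Δ` in that
place. -/

namespace FermionShapes

/-! ### Homogeneous components of products -/

section Graded

variable {K σ : Type*} [CommRing K]

theorem homogeneousComponent_mul (n : ℕ) (p q : MvPolynomial σ K) :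
    homogeneousComponent n (p * q) = ∑ x ∈ Finset.HasAntidiagonal.antidiagonal n,
      homogeneousComponent x.1 p * homogeneousComponent x.2 q := by
  classical
  ext m
  simp only [coeff_homogeneousComponent, coeff_sum, coeff_mul]
  rw [Finset.sum_comm]
  split_ifs with h
  · refine Finset.sum_congr rfl fun y hy => ?_
    have hy' : y.1 + y.2 = m := Finset.HasAntidiagonal.mem_antidiagonal.1 hy
    rw [Finset.sum_eq_single (y.1.degree, y.2.degree)]
    · simp
    · rintro ⟨i, j⟩ - hne
      by_cases hi : y.1.degree = i
      · have : y.2.degree ≠ j := fun hj => hne (by rw [hi, hj])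
        simp [this]
      · simp [hi]
    · intro hn
      exact absurd (by rw [Finset.HasAntidiagonal.mem_antidiagonal, ← h, ← hy', map_add]) hn
  · refine (Finset.sum_eq_zero fun y hy => Finset.sum_eq_zero fun x hx => ?_).symm
    have hy' : y.1 + y.2 = m := Finset.HasAntidiagonal.mem_antidiagonal.1 hy
    have hx' : x.1 + x.2 = n := Finset.HasAntidiagonal.mem_antidiagonal.1 hx
    by_cases h1 : y.1.degree = x.1
    · have : y.2.degree ≠ x.2 := fun h2 => h (by rw [← hy', map_add, h1, h2, hx'])
      simp [this]
    · simp [h1]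

theorem homogeneousComponent_of_isHomogeneous {m : ℕ} {q : MvPolynomial σ K}
    (hq : q.IsHomogeneous m) (n : ℕ) : homogeneousComponent n q = if n = m then q else 0 :=
  homogeneousComponent_of_mem ((mem_homogeneousSubmodule _ _).2 hq)

theorem homogeneousComponent_mul_of_isHomogeneous {m n : ℕ} (h : m ≤ n) (p : MvPolynomial σ K)
    {q : MvPolynomial σ K} (hq : q.IsHomogeneous m) :
    homogeneousComponent n (p * q) = homogeneousComponent (n - m) p * q := by
  rw [homogeneousComponent_mul, Finset.sum_eq_single (n - m, m)]
  · simp [homogeneousComponent_of_isHomogeneous hq]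
  · rintro ⟨i, j⟩ hx hne
    have hx' : i + j = n := Finset.HasAntidiagonal.mem_antidiagonal.1 hx
    have : j ≠ m := by
      rintro rfl
      exact hne (by rw [← hx', Nat.add_sub_cancel])
    simp [homogeneousComponent_of_isHomogeneous hq, this]
  · intro hn
    exact absurd (Finset.HasAntidiagonal.mem_antidiagonal.2 (by simp; omega)) hn

end Graded

/-- Bounds the degree, in one direction, of a monomial that occurs in an alternating polynomial. -/
theorem card_mul_pred_div_two_le_sum {N : ℕ} {f : Fin N → ℕ} (hf : Function.Injective f) :
    N * (N - 1) / 2 ≤ ∑ i, f i := by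
  have hinj : Function.Injective fun i => (f i : ℤ) := fun i j h => hf (Int.ofNat_inj.1 h)
  have h := Finset.sum_range_le_sum (s := Finset.univ.image fun i => (f i : ℤ)) (c := 0) (by simp)
  rw [Finset.sum_image hinj.injOn, Finset.card_image_of_injective _ hinj] at h
  simp only [Finset.card_univ, Fintype.card_fin, zero_add] at h
  rw [← Finset.sum_range_id, ← Nat.cast_le (α := ℤ)]
  push_cast
  exact h

/-! ### Separate permutations of the coordinate directions -/

variable {K : Type*} [Field K] {d N : ℕ}

/-- Permute the particle labels in each coordinate direction by its own permutation. -/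
noncomputable def coordAct (g : Fin d → Equiv.Perm (Fin N)) : Wave K d N →ₐ[K] Wave K d N :=
  rename fun x => (x.1, g x.1 x.2)

theorem coordAct_X (g : Fin d → Equiv.Perm (Fin N)) (x : Fin d × Fin N) :
    coordAct g (X x : Wave K d N) = X (x.1, g x.1 x.2) := rename_X _ _

theorem coordAct_coordAct (g h : Fin d → Equiv.Perm (Fin N)) (p : Wave K d N) :
    coordAct g (coordAct h p) = coordAct (g * h) p := by
  simp only [coordAct, rename_rename]
  rfl

theorem coordAct_one (p : Wave K d N) : coordAct 1 p = p := by
  simp only [coordAct, Pi.one_apply, Equiv.Perm.one_apply]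
  exact rename_id_apply p

theorem permCoord_eq (a : Fin d) (σ : Equiv.Perm (Fin N)) :
    permCoord a σ = fun x => (x.1, (Pi.mulSingle a σ : Fin d → Equiv.Perm (Fin N)) x.1 x.2) := by
  funext x
  by_cases h : x.1 = a
  · obtain ⟨b, i⟩ := x
    obtain rfl : b = a := h
    simp [permCoord]
  · simp [permCoord, h]

theorem coordAct_mulSingle (a : Fin d) (σ : Equiv.Perm (Fin N)) (p : Wave K d N) :
    coordAct (Pi.mulSingle a σ) p = rename (permCoord a σ) p := by
  rw [permCoord_eq]; rfl

theorem coordAct_of_mem {p : Wave K d N} (hp : p ∈ sepSymm K d N)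
    (g : Fin d → Equiv.Perm (Fin N)) : coordAct g p = p := by
  classical
  have key : ∀ s : Finset (Fin d), coordAct (fun a => if a ∈ s then g a else 1) p = p := by
    intro s
    induction s using Finset.induction_on with
    | empty =>
      simp only [Finset.notMem_empty, if_false]
      exact coordAct_one p
    | insert a s ha ih =>
      have h : (fun b => if b ∈ insert a s then g b else 1) =
          Pi.mulSingle a (g a) * fun b => if b ∈ s then g b else 1 := by
        funext b
        by_cases hb : b = a
        · subst hb; simp [ha]
        · simp [hb]
      rw [h, ← coordAct_coordAct, ih, coordAct_mulSingle]
      exact hp a (g a)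
  simpa using key Finset.univ

theorem mem_sepSymm_of_coordAct {p : Wave K d N}
    (hp : ∀ g : Fin d → Equiv.Perm (Fin N), coordAct g p = p) : p ∈ sepSymm K d N := fun a σ => by
  rw [← coordAct_mulSingle, hp]

theorem coordAct_smul (g : Fin d → Equiv.Perm (Fin N)) (s : sepSymm K d N) (p : Wave K d N) :
    coordAct g (s • p) = s • coordAct g p := by
  rw [Algebra.smul_def, Algebra.smul_def, map_mul]
  congr 1
  exact coordAct_of_mem s.2 g

theorem homogeneousComponent_coordAct (g : Fin d → Equiv.Perm (Fin N)) (n : ℕ) (p : Wave K d N) :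
    homogeneousComponent n (coordAct g p) = coordAct g (homogeneousComponent n p) :=
  (rename_homogeneousComponent n p).symm

theorem homogeneousComponent_mem_sepSymm {p : Wave K d N} (hp : p ∈ sepSymm K d N) (n : ℕ) :
    homogeneousComponent n p ∈ sepSymm K d N :=
  mem_sepSymm_of_coordAct fun g => by
    rw [← homogeneousComponent_coordAct, coordAct_of_mem hp]

theorem mem_sepSymmPos {s : sepSymm K d N} :
    s ∈ sepSymmPos K d N ↔ constantCoeff (s : Wave K d N) = 0 := Iff.rfl

theorem mem_antisymm {p : Wave K d N} : p ∈ antisymm K d N ↔ ∀ σ : Equiv.Perm (Fin N),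
    coordAct (fun _ => σ) p = C ((Equiv.Perm.sign σ : ℤ) : K) * p := Iff.rfl

/-! The ideal of the coinvariants. -/

/-- The ideal generated by the elements of `sepSymm K d N` without constant term. -/
noncomputable def coinvIdeal (K : Type*) [Field K] (d N : ℕ) : Ideal (Wave K d N) :=
  (sepSymmPos K d N).map (algebraMap (sepSymm K d N) (Wave K d N))

theorem mul_mem_coinvIdeal {s : sepSymm K d N} (hs : s ∈ sepSymmPos K d N) (p : Wave K d N) :
    s • p ∈ coinvIdeal K d N := by
  rw [Algebra.smul_def]
  exact Ideal.mul_mem_right _ _ (Ideal.mem_map_of_mem _ hs)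

/-- The ideal equals `S₊ • ⊤` already as an `S`-module, so `P` need not be stable under
multiplication by arbitrary polynomials. This suits maps that are only `S`-linear. -/
theorem coinvIdeal_induction {P : Wave K d N → Prop} (hadd : ∀ x y, P x → P y → P (x + y))
    (hsmul : ∀ s ∈ sepSymmPos K d N, ∀ p : Wave K d N, P (s • p))
    {x : Wave K d N} (hx : x ∈ coinvIdeal K d N) : P x := by
  refine Submodule.smul_induction_on (p := P)
    (I := (sepSymmPos K d N)) (N := (⊤ : Submodule (sepSymm K d N) (Wave K d N))) ?_
    (fun s hs p _ => hsmul s hs p) hadd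
  rw [Ideal.smul_top_eq_map]
  exact hx

theorem homogeneousComponent_mem_coinvIdeal {x : Wave K d N} (hx : x ∈ coinvIdeal K d N) (n : ℕ) :
    homogeneousComponent n x ∈ coinvIdeal K d N := by
  refine coinvIdeal_induction (P := fun x => homogeneousComponent n x ∈ coinvIdeal K d N)
    (fun x y hx hy => by rw [map_add]; exact add_mem hx hy) (fun s hs p => ?_) hx
  rw [Algebra.smul_def, homogeneousComponent_mul]
  refine sum_mem fun y _ => ?_
  refine mul_mem_coinvIdeal (s := ⟨_, homogeneousComponent_mem_sepSymm s.2 y.1⟩) ?_ _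
  rw [mem_sepSymmPos] at hs ⊢
  simp only [constantCoeff_eq, coeff_homogeneousComponent] at hs ⊢
  rw [hs, ite_self]

/-! Alternating polynomials. -/

/-- The product of the signs of the permutations of the separate directions. -/
def coordSign (g : Fin d → Equiv.Perm (Fin N)) : ℤˣ := ∏ a, Equiv.Perm.sign (g a)

theorem coordSign_mul (g h : Fin d → Equiv.Perm (Fin N)) :
    coordSign (g * h) = coordSign g * coordSign h := by
  simp [coordSign, Finset.prod_mul_distrib]

theorem coordSign_mulSingle (a : Fin d) (σ : Equiv.Perm (Fin N)) :
    coordSign (Pi.mulSingle a σ : Fin d → Equiv.Perm (Fin N)) = Equiv.Perm.sign σ := by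
  rw [coordSign, Finset.prod_eq_single a (fun b _ hb => by simp [Pi.mulSingle_eq_of_ne hb])
    (by simp)]
  simp

theorem unit_cast_mul_self (u : ℤˣ) : ((u : ℤ) : K) * ((u : ℤ) : K) = 1 := by
  rw [← Int.cast_mul, ← Units.val_mul, Int.units_mul_self]; simp

/-- The alternating sum over the permutations of the separate directions. -/
noncomputable def alternate (p : Wave K d N) : Wave K d N :=
  ∑ g : Fin d → Equiv.Perm (Fin N), C ((coordSign g : ℤ) : K) * coordAct g p

theorem coordAct_alternate (g : Fin d → Equiv.Perm (Fin N)) (p : Wave K d N) :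
    coordAct g (alternate p) = C ((coordSign g : ℤ) : K) * alternate p := by
  rw [alternate, map_sum, Finset.mul_sum]
  refine Fintype.sum_equiv (Equiv.mulLeft g) _ _ fun h => ?_
  rw [map_mul, coordAct_coordAct, Equiv.coe_mulLeft, ← mul_assoc, ← C_mul, coordSign_mul,
    Units.val_mul, Int.cast_mul, ← mul_assoc, unit_cast_mul_self, one_mul]
  congr 1
  exact AlgHom.commutes (coordAct g) _

/-- The transposition of `i` and `j` in direction `a` fixes the monomial and has sign `-1`, so the
coefficient equals its own negative. -/
theorem coeff_eq_zero_of_alternating [CharZero K] {p : Wave K d N}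
    (hp : ∀ g : Fin d → Equiv.Perm (Fin N), coordAct g p = C ((coordSign g : ℤ) : K) * p)
    (m : Fin d × Fin N →₀ ℕ) {a : Fin d} {i j : Fin N} (hij : i ≠ j) (hm : m (a, i) = m (a, j)) :
    coeff m p = 0 := by
  have h := hp (Pi.mulSingle a (Equiv.swap i j))
  rw [coordSign_mulSingle, Equiv.Perm.sign_swap hij, coordAct_mulSingle] at h
  have hinv : Function.Involutive (permCoord a (Equiv.swap i j) : Fin d × Fin N → _) := by
    rintro ⟨b, k⟩
    by_cases hb : b = a <;> simp [permCoord, hb]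
  have hmap : m.mapDomain (permCoord a (Equiv.swap i j)) = m := by
    ext x
    obtain ⟨y, rfl⟩ := hinv.surjective x
    rw [Finsupp.mapDomain_apply hinv.injective]
    obtain ⟨b, k⟩ := y
    by_cases hb : b = a
    · subst hb
      simp only [permCoord, if_true]
      rcases eq_or_ne k i with rfl | hki
      · simpa using hm
      · rcases eq_or_ne k j with rfl | hkj
        · simpa using hm.symm
        · rw [Equiv.swap_apply_of_ne_of_ne hki hkj]
    · simp [permCoord, hb]
  have h2 := congrArg (coeff m) h
  rw [← hmap, coeff_rename_mapDomain _ hinv.injective, hmap, coeff_C_mul] at h2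
  simp only [Units.val_neg, Units.val_one, Int.cast_neg, Int.cast_one, neg_mul, one_mul] at h2
  exact self_eq_neg.1 h2

theorem d_mul_div_two (d N : ℕ) : d * N * (N - 1) / 2 = d * (N * (N - 1) / 2) := by
  rw [mul_assoc, Nat.mul_div_assoc]
  exact (Nat.even_mul_pred_self N).two_dvd

/-- In a surviving monomial the exponents within each direction are distinct, so they sum to at
least `0 + 1 + ⋯ + (N-1)`. -/
theorem alternate_mem_pow [CharZero K] (p : Wave K d N) :
    alternate p ∈ idealOfVars (Fin d × Fin N) K ^ (d * N * (N - 1) / 2) := by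
  rw [mem_pow_idealOfVars_iff]
  intro m hm
  have hinj : ∀ a, Function.Injective fun i => m (a, i) := by
    intro a i j hij
    by_contra hne
    exact (mem_support_iff.1 hm)
      (coeff_eq_zero_of_alternating (fun g => coordAct_alternate g p) m hne hij)
  rw [Finsupp.degree_eq_sum, Fintype.sum_prod_type, d_mul_div_two]
  calc d * (N * (N - 1) / 2) = ∑ _a : Fin d, N * (N - 1) / 2 := by simp
    _ ≤ _ := Finset.sum_le_sum fun a _ => card_mul_pred_div_two_le_sum (hinj a)

theorem alternate_smul (s : sepSymm K d N) (p : Wave K d N) :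
    alternate (s • p) = s • alternate p := by
  simp only [alternate, coordAct_smul, Finset.smul_sum, mul_smul_comm]

theorem alternate_add (p q : Wave K d N) : alternate (p + q) = alternate p + alternate q := by
  simp [alternate, mul_add, Finset.sum_add_distrib]

theorem coordAct_vandermondeProd (g : Fin d → Equiv.Perm (Fin N)) :
    coordAct g (vandermondeProd K d N) =
      C ((coordSign g : ℤ) : K) * vandermondeProd K d N := by
  have h : ∀ a, coordAct g (Matrix.vandermonde fun i : Fin N => (X (a, i) : Wave K d N)).det =
      ((Equiv.Perm.sign (g a) : ℤ) : Wave K d N) *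
        (Matrix.vandermonde fun i : Fin N => (X (a, i) : Wave K d N)).det := by
    intro a
    rw [← Matrix.det_permute, AlgHom.map_det]
    congr 1
    ext i j : 2
    simp [Matrix.vandermonde_apply, coordAct_X]
  rw [vandermondeProd, map_prod, Finset.prod_congr rfl fun a _ => h a, Finset.prod_mul_distrib]
  congr 1
  simp [coordSign, Units.coe_prod]

theorem isHomogeneous_vandermondeProd :
    (vandermondeProd K d N).IsHomogeneous (d * N * (N - 1) / 2) := by
  rw [d_mul_div_two]
  have h := IsHomogeneous.prod (R := K) (Finset.univ : Finset (Fin d))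
    (fun a => (Matrix.vandermonde fun i : Fin N => (X (a, i) : Wave K d N)).det)
    (fun _ => N * (N - 1) / 2) (fun a _ => ?_)
  · rw [vandermondeProd]
    rw [Finset.sum_const, Finset.card_univ, Fintype.card_fin, smul_eq_mul] at h
    exact h
  · rw [Matrix.det_apply']
    refine IsHomogeneous.sum _ _ _ fun σ _ => ?_
    have h1 : (((Equiv.Perm.sign σ : ℤ)) : Wave K d N).IsHomogeneous 0 := by
      rw [← map_intCast (C : K →+* Wave K d N)]; exact isHomogeneous_C _ _
    have h2 := h1.mul (IsHomogeneous.prod (R := K) (Finset.univ : Finset (Fin N))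
      (fun i => Matrix.vandermonde (fun i : Fin N => (X (a, i) : Wave K d N)) (σ i) i)
      (fun i => (i : ℕ)) fun i _ => isHomogeneous_X_pow _ _)
    rwa [zero_add, Fin.sum_univ_eq_sum_range (fun i => i), Finset.sum_range_id] at h2

theorem vandermondeProd_ne_zero : vandermondeProd K d N ≠ 0 := by
  rw [vandermondeProd, Finset.prod_ne_zero_iff]
  intro a _
  rw [Matrix.det_vandermonde_ne_zero_iff]
  intro i j h
  simpa using X_injective h

theorem vandermondeProd_notMem_coinvIdeal [CharZero K] :
    vandermondeProd K d N ∉ coinvIdeal K d N := by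
  intro hmem
  -- A factor from `S₊` passes through the alternation and raises the order by at least one.
  have h1 : alternate (vandermondeProd K d N) ∈
      idealOfVars (Fin d × Fin N) K ^ (d * N * (N - 1) / 2 + 1) := by
    refine coinvIdeal_induction (P := fun x => alternate x ∈
      idealOfVars (Fin d × Fin N) K ^ (d * N * (N - 1) / 2 + 1)) ?_ ?_ hmem
    · intro x y hx hy
      rw [alternate_add]
      exact add_mem hx hy
    · intro s hs p
      rw [alternate_smul, Algebra.smul_def, pow_succ']
      refine Ideal.mul_mem_mul ?_ (alternate_mem_pow p)
      rw [← pow_one (idealOfVars _ _), mem_pow_idealOfVars_iff]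
      intro m hm
      rw [Nat.one_le_iff_ne_zero]
      intro h0
      rw [Finsupp.degree_eq_zero_iff] at h0
      subst h0
      exact mem_support_iff.1 hm hs
  have h2 : alternate (vandermondeProd K d N) =
      C (Fintype.card (Fin d → Equiv.Perm (Fin N)) : K) * vandermondeProd K d N := by
    simp only [alternate, coordAct_vandermondeProd, ← mul_assoc, ← C_mul, unit_cast_mul_self]
    simp [← Finset.card_univ]
  have hc : (Fintype.card (Fin d → Equiv.Perm (Fin N)) : K) ≠ 0 :=
    Nat.cast_ne_zero.2 Fintype.card_ne_zero
  obtain ⟨m, hm⟩ := ne_zero_iff.1 (vandermondeProd_ne_zero (K := K) (d := d) (N := N))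
  rw [h2, mem_pow_idealOfVars_iff] at h1
  have h3 := h1 m (by rw [mem_support_iff, coeff_C_mul]; exact mul_ne_zero hc hm)
  exact hm (isHomogeneous_vandermondeProd.coeff_eq_zero (by omega))

/-! The antisymmetrizer. -/

/-- The projection onto the diagonally antisymmetric polynomials. -/
noncomputable def antisymmetrize (K : Type*) [Field K] (d N : ℕ) :
    Wave K d N →ₗ[sepSymm K d N] Wave K d N where
  toFun p := C (N.factorial : K)⁻¹ * ∑ σ : Equiv.Perm (Fin N),
    C ((Equiv.Perm.sign σ : ℤ) : K) * coordAct (fun _ => σ) p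
  map_add' p q := by simp only [map_add, mul_add, Finset.sum_add_distrib]
  map_smul' s p := by
    simp only [coordAct_smul, mul_smul_comm, ← Finset.smul_sum, RingHom.id_apply]

theorem antisymmetrize_apply (p : Wave K d N) : antisymmetrize K d N p =
    C (N.factorial : K)⁻¹ * ∑ σ : Equiv.Perm (Fin N),
      C ((Equiv.Perm.sign σ : ℤ) : K) * coordAct (fun _ => σ) p := rfl

theorem antisymmetrize_mem (p : Wave K d N) : antisymmetrize K d N p ∈ antisymm K d N := by
  rw [mem_antisymm]
  intro σ
  have hC : ∀ c : K, coordAct (fun _ => σ) (C c : Wave K d N) = C c :=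
    fun c => AlgHom.commutes (coordAct fun _ => σ) c
  rw [antisymmetrize_apply, map_mul, hC, mul_left_comm, map_sum]
  congr 1
  rw [Finset.mul_sum]
  refine Fintype.sum_equiv (Equiv.mulLeft σ) _ _ fun τ => ?_
  rw [map_mul, hC, coordAct_coordAct, Equiv.coe_mulLeft, ← mul_assoc, ← C_mul,
    Equiv.Perm.sign_mul, Units.val_mul, Int.cast_mul, ← mul_assoc, unit_cast_mul_self, one_mul]
  rfl

theorem antisymmetrize_of_mem [CharZero K] {p : Wave K d N} (hp : p ∈ antisymm K d N) :
    antisymmetrize K d N p = p := by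
  rw [antisymmetrize_apply]
  simp only [mem_antisymm.1 hp, ← mul_assoc, ← C_mul, unit_cast_mul_self]
  simp only [map_one, one_mul, Finset.sum_const, Finset.card_univ, Fintype.card_perm,
    Fintype.card_fin, nsmul_eq_mul]
  rw [← map_natCast (C : K →+* Wave K d N), ← mul_assoc, ← C_mul,
    inv_mul_cancel₀ (Nat.cast_ne_zero.2 (Nat.factorial_ne_zero N)), C_1, one_mul]

theorem isHomogeneous_antisymmetrize {p : Wave K d N} {n : ℕ} (hp : p.IsHomogeneous n) :
    (antisymmetrize K d N p).IsHomogeneous n := by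
  rw [antisymmetrize_apply]
  refine IsHomogeneous.C_mul (IsHomogeneous.sum _ _ _ fun (σ : Equiv.Perm (Fin N)) _ => ?_) _
  exact IsHomogeneous.C_mul hp.rename_isHomogeneous _

theorem antisymmetrize_mem_excitations {x : Wave K d N} (hx : x ∈ coinvIdeal K d N) :
    antisymmetrize K d N x ∈ excitations K d N := by
  refine coinvIdeal_induction (P := fun x => antisymmetrize K d N x ∈ excitations K d N)
    (fun x y hx hy => by rw [map_add]; exact add_mem hx hy) (fun s hs p => ?_) hx
  rw [map_smul]
  exact Submodule.smul_mem_smul hs (antisymmetrize_mem p)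

theorem excitations_le_coinvIdeal {x : Wave K d N} (hx : x ∈ excitations K d N) :
    x ∈ coinvIdeal K d N :=
  Submodule.smul_induction_on hx (fun _ hs p _ => mul_mem_coinvIdeal hs p) fun _ _ => add_mem

theorem excitations_le_antisymm : excitations K d N ≤ antisymm K d N :=
  Submodule.smul_le.2 fun s _ _ hp => Submodule.smul_mem _ s hp

/-- The antisymmetrizer is `S`-linear, so it maps `S₊R` into `S₊A`, and it fixes `A`. -/
theorem mem_excitations_iff [CharZero K] {x : Wave K d N} :
    x ∈ excitations K d N ↔ x ∈ coinvIdeal K d N ∧ x ∈ antisymm K d N :=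
  ⟨fun h => ⟨excitations_le_coinvIdeal h, excitations_le_antisymm h⟩, fun h => by
    rw [← antisymmetrize_of_mem h.2]; exact antisymmetrize_mem_excitations h.1⟩

/-- A diagonal permutation contributes its sign once per direction, and an odd power of a sign is
that sign. -/
theorem vandermondeProd_mem_antisymm (hd : Odd d) : vandermondeProd K d N ∈ antisymm K d N := by
  rw [mem_antisymm]
  intro σ
  rw [coordAct_vandermondeProd]
  congr 4
  rw [coordSign, Finset.prod_const, Finset.card_univ, Fintype.card_fin]
  rcases Int.units_eq_one_or (Equiv.Perm.sign σ) with h | h <;> simp [h, hd.neg_one_pow]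

/-! ### Staircase monomials span over the symmetric polynomials -/

/-- Adjoin the generators in order of increasing `ρ`: each satisfies a monic equation of degree `m
t` over the algebra generated by those of smaller `ρ`, so its powers below `m t` suffice. -/
theorem adjoin_image_le_span_prod_pow {S R ι : Type*} [CommRing S] [CommRing R] [Algebra S R]
    (x : ι → R) (m : ι → ℕ) (ρ : ι → ℕ)
    (h : ∀ t, ∃ f : Polynomial R, f.Monic ∧ f.natDegree = m t ∧ f.eval (x t) = 0 ∧
      ∀ k, f.coeff k ∈ Algebra.adjoin S (x '' {u | ρ u < ρ t}))
    (hm : ∀ t, 0 < m t) (s : Finset ι) (hs : ∀ t ∈ s, ∀ u, ρ u < ρ t → u ∈ s) :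
    Subalgebra.toSubmodule (Algebra.adjoin S (x '' s)) ≤
      Submodule.span S {y | ∃ α : ι → ℕ, (∀ t, α t < m t) ∧ y = ∏ t ∈ s, x t ^ α t} := by
  classical
  induction s using Finset.induction_on_max_value ρ with
  | empty =>
    rw [Finset.coe_empty, Set.image_empty, Algebra.adjoin_empty, Algebra.toSubmodule_bot,
      Submodule.one_eq_span]
    exact Submodule.span_mono (by rintro _ rfl; exact ⟨fun _ => 0, hm, by simp⟩)
  | insert a s ha hmax ih =>
    have hs' : ∀ t ∈ s, ∀ u, ρ u < ρ t → u ∈ s := fun t ht u hu => by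
      rcases Finset.mem_insert.1 (hs t (Finset.mem_insert_of_mem ht) u hu) with rfl | h'
      · exact absurd (hmax t ht) (not_le.2 hu)
      · exact h'
    have hP : x '' {u | ρ u < ρ a} ⊆ x '' s := by
      refine Set.image_mono fun u hu => ?_
      rcases Finset.mem_insert.1 (hs a (Finset.mem_insert_self _ _) u hu) with rfl | h'
      · exact absurd (show ρ u < ρ u from hu) (lt_irrefl _)
      · exact h'
    set B := Algebra.adjoin S (x '' (s : Set ι)) with hB
    obtain ⟨f, hf, hdeg, hroot, hcoeff⟩ := h a
    obtain ⟨q, hq, hqdeg, hqm⟩ := Polynomial.lifts_and_natDegree_eq_and_monic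
      (f := algebraMap B R) (p := f) ((Polynomial.lifts_iff_coeff_lifts _).2 fun k =>
        ⟨⟨_, Algebra.adjoin_mono hP (hcoeff k)⟩, rfl⟩) hf
    have hspan := Submodule.span_range_natDegree_eq_adjoin (x := x a) hqm
      (by rw [Polynomial.aeval_def, ← Polynomial.eval_map, hq, hroot])
    set P : Submodule S R := Submodule.span S {y | ∃ k < m a, y = x a ^ k} with hPdef
    have h1 : ∀ y ∈ Algebra.adjoin B {x a}, y ∈ Subalgebra.toSubmodule B * P := by
      intro y hy
      rw [← Subalgebra.mem_toSubmodule, ← hspan] at hy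
      induction hy using Submodule.span_induction with
      | mem y hy =>
        obtain ⟨k, hk, rfl⟩ := Finset.mem_image.1 (Finset.mem_coe.1 hy)
        rw [← one_mul (x a ^ k)]
        exact Submodule.mul_mem_mul B.one_mem
          (Submodule.subset_span ⟨k, by rw [← hdeg, ← hqdeg]; exact Finset.mem_range.1 hk, rfl⟩)
      | zero => exact zero_mem _
      | add y z _ _ hy hz => exact add_mem hy hz
      | smul b y _ hy =>
        rw [← Subalgebra.isIdempotentElem_toSubmodule B, mul_assoc, Algebra.smul_def]
        exact Submodule.mul_mem_mul b.2 hy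
    intro y hy
    rw [Finset.coe_insert, Set.image_insert_eq, Set.insert_eq, Set.union_comm,
      Subalgebra.mem_toSubmodule, Algebra.adjoin_union_eq_adjoin_adjoin,
      Subalgebra.mem_restrictScalars] at hy
    have h2 := mul_le_mul' (ih hs') (le_refl P) (h1 y hy)
    rw [hPdef, Submodule.span_mul_span] at h2
    refine Submodule.span_mono ?_ h2
    rintro _ ⟨_, ⟨α, hα, rfl⟩, _, ⟨k, hk, rfl⟩, rfl⟩
    refine ⟨Function.update α a k, fun t => ?_, ?_⟩
    · rcases eq_or_ne t a with rfl | ht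
      · simpa using hk
      · simpa [ht] using hα t
    · rw [Finset.prod_insert ha, Function.update_self, mul_comm]
      congr 1
      refine Finset.prod_congr rfl fun t ht => ?_
      rw [Function.update_of_ne (by rintro rfl; exact ha ht)]

theorem X_sub_C_mem_lifts {B R : Type*} [CommRing B] [CommRing R] {φ : B →+* R} {x : R}
    (hx : x ∈ Set.range φ) : Polynomial.X - Polynomial.C x ∈ Polynomial.lifts φ := by
  obtain ⟨b, rfl⟩ := hx
  exact (Polynomial.mem_lifts _).2 ⟨Polynomial.X - Polynomial.C b, by simp⟩

/-- Division by a monic polynomial commutes with base change, so the quotient computed over `B` maps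
to `f`. -/
theorem mem_lifts_of_monic_mul_mem {B R : Type*} [CommRing B] [CommRing R] {φ : B →+* R}
    {f g : Polynomial R} (hgm : g.Monic) (hg : g ∈ Polynomial.lifts φ)
    (hgf : g * f ∈ Polynomial.lifts φ) : f ∈ Polynomial.lifts φ := by
  obtain ⟨G, hG, -, hGm⟩ := Polynomial.lifts_and_natDegree_eq_and_monic hg hgm
  obtain ⟨F, hF⟩ := (Polynomial.mem_lifts _).1 hgf
  refine (Polynomial.mem_lifts _).2 ⟨F /ₘ G, ?_⟩
  rw [Polynomial.map_divByMonic _ hGm, hF, hG, Polynomial.mul_divByMonic_cancel_left _ hgm]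

/-- The full product has coefficients in `S`; dividing out the factors with `j > i`, which are
defined over `B`, leaves the partial product. -/
theorem coeff_partial_prod_mem {S R : Type*} [CommRing S] [CommRing R] [Algebra S R] {N : ℕ}
    {x : Fin N → R} (hx : ∀ k, (∏ j, (Polynomial.X - Polynomial.C (x j))).coeff k ∈
      Set.range (algebraMap S R)) (i : Fin N) (B : Subalgebra S R) (hB : ∀ j, i < j → x j ∈ B)
    (k : ℕ) : (∏ j with j ≤ i, (Polynomial.X - Polynomial.C (x j))).coeff k ∈ B := by
  have hg : ∏ j with ¬ j ≤ i, (Polynomial.X - Polynomial.C (x j)) ∈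
      Polynomial.lifts (algebraMap B R) :=
    Subsemiring.prod_mem _ fun j hj =>
      X_sub_C_mem_lifts ⟨⟨_, hB j (not_le.1 (Finset.mem_filter.1 hj).2)⟩, rfl⟩
  have hgf : (∏ j with ¬ j ≤ i, (Polynomial.X - Polynomial.C (x j))) *
      ∏ j with j ≤ i, (Polynomial.X - Polynomial.C (x j)) ∈ Polynomial.lifts (algebraMap B R) := by
    rw [mul_comm, Finset.prod_filter_mul_prod_filter_not, Polynomial.lifts_iff_coeff_lifts]
    intro k
    obtain ⟨s, hs⟩ := hx k
    exact ⟨algebraMap S B s, hs⟩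
  obtain ⟨b, hb⟩ := (Polynomial.lifts_iff_coeff_lifts _).1 (mem_lifts_of_monic_mul_mem
    (Polynomial.monic_prod_of_monic _ _ fun j _ => Polynomial.monic_X_sub_C _) hg hgf) k
  rw [← hb]
  exact b.2

variable {K : Type*} [Field K] {d N : ℕ}

theorem coeff_prod_X_sub_C_mem (a : Fin d) (k : ℕ) :
    (∏ j : Fin N, (Polynomial.X - Polynomial.C (X (a, j) : Wave K d N))).coeff k ∈
      sepSymm K d N := by
  refine mem_sepSymm_of_coordAct fun g => ?_
  have h : (∏ j : Fin N, (Polynomial.X - Polynomial.C (X (a, j) : Wave K d N))).map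
      ((coordAct g : Wave K d N →ₐ[K] Wave K d N) : Wave K d N →+* Wave K d N) =
      ∏ j : Fin N, (Polynomial.X - Polynomial.C (X (a, j) : Wave K d N)) := by
    rw [Polynomial.map_prod]
    refine Fintype.prod_equiv (g a) _ _ fun j => ?_
    simp [coordAct_X]
  conv_rhs => rw [← h, Polynomial.coeff_map]
  rfl

/-- The staircase monomials. -/
noncomputable def stairMonomial (K : Type*) [Field K] {d N : ℕ}
    (α : (x : Fin d × Fin N) → Fin (x.2 + 1)) : Wave K d N :=
  ∏ x, X x ^ (α x : ℕ)

theorem span_stairMonomial :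
    Submodule.span (sepSymm K d N) (Set.range (stairMonomial K (d := d) (N := N))) = ⊤ := by
  rw [eq_top_iff]
  have h := adjoin_image_le_span_prod_pow (S := sepSymm K d N) (X : Fin d × Fin N → Wave K d N)
    -- The rank `N - x.2` reverses the particle order: the equation for particle `i` has the roots
    -- `0, …, i`, hence degree `i + 1`, and its coefficients involve only particles after `i`.
    (fun x => x.2 + 1) (fun x => N - x.2) (fun x => ?_) (fun x => Nat.succ_pos _) Finset.univ
    (fun _ _ _ _ => Finset.mem_univ _)
  · intro p _
    have hp : p ∈ Algebra.adjoin (sepSymm K d N)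
        ((X : Fin d × Fin N → Wave K d N) '' (Finset.univ : Finset (Fin d × Fin N))) := by
      have h1 : Algebra.adjoin K (Set.range (X : Fin d × Fin N → Wave K d N)) ≤
          (Algebra.adjoin (sepSymm K d N) ((X : Fin d × Fin N → Wave K d N) ''
            (Finset.univ : Finset (Fin d × Fin N)))).restrictScalars K :=
        Algebra.adjoin_le (by
          rw [Finset.coe_univ, Set.image_univ]
          exact Algebra.subset_adjoin)
      rw [MvPolynomial.adjoin_range_X] at h1
      exact h1 Algebra.mem_top
    refine Submodule.span_mono ?_ (h hp)
    rintro _ ⟨α, hα, rfl⟩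
    exact ⟨fun x => ⟨α x, hα x⟩, rfl⟩
  · refine ⟨∏ j ∈ Finset.univ.filter (· ≤ x.2),
      (Polynomial.X - Polynomial.C (X (x.1, j) : Wave K d N)),
      Polynomial.monic_prod_of_monic _ _ fun j _ => Polynomial.monic_X_sub_C _, ?_, ?_,
      coeff_partial_prod_mem (fun k => ⟨⟨_, coeff_prod_X_sub_C_mem x.1 k⟩, rfl⟩) x.2 _
        fun j hj => Algebra.subset_adjoin ⟨(x.1, j), ?_, rfl⟩⟩
    · rw [Polynomial.natDegree_prod_of_monic _ _ fun j _ => Polynomial.monic_X_sub_C _]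
      simp only [Polynomial.natDegree_X_sub_C, Finset.sum_const, smul_eq_mul, mul_one]
      rw [Finset.filter_ge_eq_Iic, Fin.card_Iic]
    · rw [Polynomial.eval_prod]
      exact Finset.prod_eq_zero (i := x.2) (by simp) (by simp)
    · have h1 : N - (j : ℕ) < N - (x.2 : ℕ) := by have := j.2; omega
      exact h1

/-- Bounds the dimension of `R/J` by the order of the group, the count needed for linear
independence. -/
theorem card_stair :
    Fintype.card ((x : Fin d × Fin N) → Fin (x.2 + 1)) =
      Fintype.card (Fin d → Equiv.Perm (Fin N)) := by
  simp only [Fintype.card_pi, Fintype.card_fin, Fintype.prod_prod_type, Fintype.card_perm]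
  refine Finset.prod_congr rfl fun _ _ => ?_
  rw [Fin.prod_univ_eq_prod_range (fun i => i + 1), Finset.prod_range_add_one_eq_factorial]

/-! ### The quotient by the coinvariant ideal and its top degree -/

theorem sub_constantCoeff_mem (s : sepSymm K d N) :
    s - algebraMap K (sepSymm K d N) (constantCoeff (s : Wave K d N)) ∈ sepSymmPos K d N := by
  rw [mem_sepSymmPos]
  change constantCoeff ((s : Wave K d N) - C (constantCoeff (s : Wave K d N))) = 0
  simp

theorem sub_C_mul_mem_coinvIdeal (s : sepSymm K d N) (p : Wave K d N) :
    s • p - C (constantCoeff (s : Wave K d N)) * p ∈ coinvIdeal K d N := by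
  have := mul_mem_coinvIdeal (sub_constantCoeff_mem s) p
  rw [sub_smul] at this
  exact this

/-- Modulo the coinvariant ideal, a spanning family over the symmetric polynomials spans over
the field. -/
theorem exists_sub_sum_mem_coinvIdeal {ι : Type*} [Fintype ι] {h : ι → Wave K d N}
    (hh : Submodule.span (sepSymm K d N) (Set.range h) = ⊤) (p : Wave K d N) :
    ∃ c : ι → K, p - ∑ i, C (c i) * h i ∈ coinvIdeal K d N := by
  obtain ⟨s, rfl⟩ := (Submodule.mem_span_range_iff_exists_fun _).1
    (hh ▸ Submodule.mem_top : p ∈ Submodule.span (sepSymm K d N) (Set.range h))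
  refine ⟨fun i => constantCoeff (s i : Wave K d N), ?_⟩
  rw [← Finset.sum_sub_distrib]
  exact sum_mem fun i _ => sub_C_mul_mem_coinvIdeal _ _

theorem isHomogeneous_stairMonomial (α : (x : Fin d × Fin N) → Fin (x.2 + 1)) :
    (stairMonomial K α).IsHomogeneous (∑ x, (α x : ℕ)) :=
  IsHomogeneous.prod _ _ _ fun _ _ => isHomogeneous_X_pow _ _

theorem sum_stair : ∑ x : Fin d × Fin N, (x.2 : ℕ) = d * N * (N - 1) / 2 := by
  rw [Fintype.sum_prod_type, d_mul_div_two, ← Finset.sum_range_id]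
  simp [Fin.sum_univ_eq_sum_range (fun i => i)]

theorem isHomogeneous_sub_sum_mem {p : Wave K d N} {n : ℕ} (hp : p.IsHomogeneous n) :
    ∃ c : ((x : Fin d × Fin N) → Fin (x.2 + 1)) → K,
      p - ∑ α with ∑ x, (α x : ℕ) = n, C (c α) * stairMonomial K α ∈ coinvIdeal K d N := by
  obtain ⟨c, hc⟩ := exists_sub_sum_mem_coinvIdeal span_stairMonomial p
  refine ⟨c, ?_⟩
  have h := homogeneousComponent_mem_coinvIdeal hc n
  rw [map_sub, homogeneousComponent_eq_self hp, map_sum] at h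
  convert h using 2
  rw [Finset.sum_filter]
  refine Finset.sum_congr rfl fun α _ => ?_
  rw [homogeneousComponent_C_mul,
    homogeneousComponent_of_isHomogeneous (isHomogeneous_stairMonomial α)]
  simp [eq_comm]

theorem mem_coinvIdeal_of_isHomogeneous {p : Wave K d N} {n : ℕ} (hp : p.IsHomogeneous n)
    (hn : d * N * (N - 1) / 2 < n) : p ∈ coinvIdeal K d N := by
  obtain ⟨c, hc⟩ := isHomogeneous_sub_sum_mem hp
  rwa [Finset.sum_eq_zero, sub_zero] at hc
  intro α hα
  have h1 : ∑ x, (α x : ℕ) ≤ ∑ x : Fin d × Fin N, (x.2 : ℕ) :=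
    Finset.sum_le_sum fun x _ => Nat.lt_succ_iff.1 (α x).2
  rw [(Finset.mem_filter.1 hα).2, sum_stair] at h1
  omega

/-- Only the staircase monomial with all exponents maximal has the top degree. -/
theorem exists_sub_C_mul_top_mem {p : Wave K d N}
    (hp : p.IsHomogeneous (d * N * (N - 1) / 2)) :
    ∃ c : K, p - C c * stairMonomial K (fun _ => Fin.last _) ∈ coinvIdeal K d N := by
  obtain ⟨c, hc⟩ := isHomogeneous_sub_sum_mem hp
  refine ⟨c fun _ => Fin.last _, ?_⟩
  convert hc using 2
  rw [Finset.sum_eq_single (fun _ => Fin.last _)]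
  · intro α hα hne
    refine absurd (funext fun x => ?_) hne
    have h1 := (Finset.mem_filter.1 hα).2
    rw [← sum_stair] at h1
    exact Fin.ext ((Finset.sum_eq_sum_iff_of_le fun x _ => Nat.lt_succ_iff.1 (α x).2).1 h1 x
      (Finset.mem_univ _))
  · intro hn
    exact absurd (Finset.mem_filter.2 ⟨Finset.mem_univ _, by simp [sum_stair]⟩) hn

theorem exists_sub_C_mul_vandermondeProd_mem [CharZero K] {p : Wave K d N}
    (hp : p.IsHomogeneous (d * N * (N - 1) / 2)) :
    ∃ c : K, p - C c * vandermondeProd K d N ∈ coinvIdeal K d N := by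
  obtain ⟨c, hc⟩ := exists_sub_C_mul_top_mem hp
  obtain ⟨b, hb⟩ := exists_sub_C_mul_top_mem (isHomogeneous_vandermondeProd (K := K) (d := d) (N := N))
  have hb0 : b ≠ 0 := by
    rintro rfl
    rw [C_0, zero_mul, sub_zero] at hb
    exact vandermondeProd_notMem_coinvIdeal hb
  refine ⟨c / b, ?_⟩
  have h := sub_mem hc (Ideal.mul_mem_left _ (C (c / b)) hb)
  convert h using 1
  have : (C c : Wave K d N) = C (c / b) * C b := by rw [← C_mul, div_mul_cancel₀ _ hb0]
  rw [this]
  ring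

/-! ### Linear independence by counting -/

/-- A family of at most `card G` elements that spans a domain over a ring of common invariants of
`card G` distinct endomorphisms is linearly independent. -/
theorem linearIndependent_of_span_eq_top {S R G ι : Type*} [CommRing S] [CommRing R] [IsDomain R]
    [Algebra S R] [FaithfulSMul S R] [Fintype G] [Fintype ι] {φ : G → R →ₐ[S] R}
    (hφ : Function.Injective φ) {h : ι → R} (hh : Submodule.span S (Set.range h) = ⊤)
    (hcard : Fintype.card ι ≤ Fintype.card G) : LinearIndependent S h := by
  classical
  -- By `S`-linearity a combination of the `φ g` that vanishes on the spanning family vanishes on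
  -- `R`; Dedekind's independence of characters then applies.
  have hcomb : ∀ c : G → R, (∀ i, ∑ g, c g * φ g (h i) = 0) → c = 0 := by
    intro c hc
    have hall : ∀ r, ∑ g, c g * φ g r = 0 := by
      intro r
      have hr : r ∈ Submodule.span S (Set.range h) := hh ▸ Submodule.mem_top
      induction hr using Submodule.span_induction with
      | mem x hx => obtain ⟨i, rfl⟩ := hx; exact hc i
      | zero => simp
      | add x y _ _ hx hy => simp only [map_add, mul_add, Finset.sum_add_distrib, hx, hy, add_zero]
      | smul s x _ hx => simp only [map_smul, mul_smul_comm, ← Finset.smul_sum, hx, smul_zero]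
    have hinj : Function.Injective fun g => ((φ g : R →* R)) := fun g g' hgg =>
      hφ (AlgHom.ext fun r => DFunLike.congr_fun hgg r)
    have hli := (linearIndependent_monoidHom R R).comp _ hinj
    rw [Fintype.linearIndependent_iff] at hli
    exact funext (hli c (funext fun r => by simpa using hall r))
  let L : (G → R) →ₗ[R] (ι → R) :=
    { toFun := fun c i => ∑ g, c g * φ g (h i)
      map_add' := fun c c' => by ext i; simp [add_mul, Finset.sum_add_distrib]
      map_smul' := fun r c => by ext i; simp [mul_assoc, Finset.mul_sum] }
  have hL : Function.Injective L := (injective_iff_map_eq_zero L).2 fun c hc =>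
    hcomb c fun i => congrFun hc i
  -- Injectivity of `R^G → R^ι` forces the opposite inequality of cardinalities, so the matrix `M`
  -- below is square.
  have hcard' : Fintype.card ι = Fintype.card G := le_antisymm hcard (card_le_of_injective R L hL)
  let e : ι ≃ G := Fintype.equivOfCardEq hcard'
  let M : Matrix ι ι R := fun j i => φ (e j) (h i)
  have hdet : M.det ≠ 0 := by
    intro h0
    obtain ⟨v, hv, hv0⟩ := Matrix.exists_vecMul_eq_zero_iff.2 h0
    refine hv (funext fun j => ?_)
    have := hcomb (fun g => v (e.symm g)) fun i => by
      refine Eq.trans ?_ (congrFun hv0 i)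
      exact Fintype.sum_equiv e.symm _ _ fun g => by simp [M]
    simpa using congrFun this (e j)
  rw [Fintype.linearIndependent_iff]
  intro s hs i
  by_contra hsi
  -- Applying every `φ g` to an `S`-relation among the `h i` leaves its coefficients unchanged, so
  -- they form a kernel vector of `M`.
  refine hdet (Matrix.exists_mulVec_eq_zero_iff.1 ⟨fun i => algebraMap S R (s i), fun h0 => ?_, ?_⟩)
  · exact hsi ((FaithfulSMul.algebraMap_injective S R) (by rw [map_zero]; exact congrFun h0 i))
  · ext j
    have := congrArg (φ (e j)) hs
    rw [map_sum, map_zero] at this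
    rw [Pi.zero_apply, ← this]
    refine Finset.sum_congr rfl fun i _ => ?_
    rw [map_smul, Algebra.smul_def, mul_comm]

variable {K : Type*} [Field K] {d N : ℕ}

/-- The separate permutations as algebra homomorphisms over their invariants. -/
noncomputable def coordActHom (K : Type*) [Field K] {d N : ℕ} (g : Fin d → Equiv.Perm (Fin N)) :
    Wave K d N →ₐ[sepSymm K d N] Wave K d N :=
  { (coordAct g : Wave K d N →ₐ[K] Wave K d N).toRingHom with
    commutes' := fun s => coordAct_of_mem s.2 g }

theorem coordActHom_injective : Function.Injective (coordActHom K (d := d) (N := N)) := by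
  intro g g' h
  funext a
  ext i : 1
  have h1 : coordAct g (X (a, i) : Wave K d N) = coordAct g' (X (a, i)) :=
    DFunLike.congr_fun h (X (a, i))
  rw [coordAct_X, coordAct_X] at h1
  exact (Prod.mk.inj (X_injective h1)).2

theorem linearIndependent_sepSymm {ι : Type*} [Fintype ι] {h : ι → Wave K d N}
    (hh : Submodule.span (sepSymm K d N) (Set.range h) = ⊤)
    (hcard : Fintype.card ι ≤ Fintype.card (Fin d → Equiv.Perm (Fin N))) :
    LinearIndependent (sepSymm K d N) h :=
  linearIndependent_of_span_eq_top coordActHom_injective hh hcard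

/-! ### Graded Nakayama and existence of shape systems -/

/-- Graded Nakayama lemma: homogeneous polynomials that span modulo the coinvariant ideal
generate. -/
theorem span_eq_top_of_sub_sum_mem {ι : Type*} [Fintype ι] {h : ι → Wave K d N} {n : ι → ℕ}
    (hn : ∀ i, (h i).IsHomogeneous (n i))
    (hh : ∀ p, ∃ c : ι → K, p - ∑ i, C (c i) * h i ∈ coinvIdeal K d N) :
    Submodule.span (sepSymm K d N) (Set.range h) = ⊤ := by
  set M := Submodule.span (sepSymm K d N) (Set.range h) with hM
  have hC : ∀ (c : K) (i : ι), C c * h i ∈ M := fun c i => by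
    have := M.smul_mem (algebraMap K (sepSymm K d N) c) (Submodule.subset_span ⟨i, rfl⟩ : h i ∈ M)
    exact this
  have key : ∀ k (p : Wave K d N), homogeneousComponent k p ∈ M := by
    intro k
    induction k using Nat.strong_induction_on with
    | _ k ih =>
      intro p
      obtain ⟨c, hc⟩ := hh p
      have h1 : ∀ x ∈ coinvIdeal K d N, homogeneousComponent k x ∈ M := by
        intro x hx
        refine coinvIdeal_induction (P := fun x => homogeneousComponent k x ∈ M)
          (fun x y hx hy => by rw [map_add]; exact add_mem hx hy) (fun s hs q => ?_) hx
        rw [Algebra.smul_def, homogeneousComponent_mul]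
        refine sum_mem fun y hy => ?_
        have hy' : y.1 + y.2 = k := Finset.HasAntidiagonal.mem_antidiagonal.1 hy
        -- An element of `S₊` has no component of degree 0, so the other factor has degree below `k`
        -- and the induction hypothesis applies.
        rcases Nat.eq_zero_or_pos y.1 with h0 | hpos
        · have : homogeneousComponent y.1 (algebraMap (sepSymm K d N) (Wave K d N) s) = 0 := by
            rw [h0, homogeneousComponent_zero]
            exact (congrArg C (mem_sepSymmPos.1 hs)).trans C_0
          rw [this, zero_mul]
          exact zero_mem _
        · have h2 := M.smul_mem (⟨_, homogeneousComponent_mem_sepSymm s.2 y.1⟩ : sepSymm K d N)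
            (ih y.2 (by omega) q)
          exact h2
      have h2 := h1 _ hc
      rw [map_sub, map_sum] at h2
      have h3 : ∑ i, homogeneousComponent k (C (c i) * h i) ∈ M := sum_mem fun i _ => by
        rw [homogeneousComponent_C_mul, homogeneousComponent_of_isHomogeneous (hn i)]
        split_ifs
        · exact hC _ _
        · rw [mul_zero]; exact zero_mem _
      have := add_mem h2 h3
      rwa [sub_add_cancel] at this
  rw [eq_top_iff]
  intro p _
  rw [← sum_homogeneousComponent p]
  exact sum_mem fun k _ => key k p

theorem exists_isHomogeneous_basis [CharZero K] :
    ∃ (ι : Type) (_ : Fintype ι) (h : ι → Wave K d N), LinearIndependent (sepSymm K d N) h ∧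
      Submodule.span (sepSymm K d N) (Set.range h) = ⊤ ∧ (∀ i, ∃ n, (h i).IsHomogeneous n) ∧
      ∀ i, h i ∈ antisymm K d N ∨ antisymmetrize K d N (h i) = 0 := by
  classical
  let V := Wave K d N ⧸ coinvIdeal K d N
  let π : Wave K d N →ₗ[K] V := (Ideal.Quotient.mkₐ K (coinvIdeal K d N)).toLinearMap
  have hπ : ∀ p, π p = 0 ↔ p ∈ coinvIdeal K d N := fun p => Ideal.Quotient.eq_zero_iff_mem
  have hπC : ∀ (c : K) (p : Wave K d N), π (C c * p) = c • π p := fun c p => by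
    rw [← map_smul, smul_eq_C_mul]
  have hstair : Submodule.span K (Set.range fun α => π (stairMonomial K (d := d) (N := N) α)) =
      ⊤ := by
    rw [eq_top_iff]
    rintro v -
    obtain ⟨p, rfl⟩ := Ideal.Quotient.mk_surjective v
    obtain ⟨c, hc⟩ := exists_sub_sum_mem_coinvIdeal span_stairMonomial p
    rw [← hπ, map_sub, sub_eq_zero, map_sum] at hc
    change π p ∈ _
    rw [hc]
    refine sum_mem fun α _ => ?_
    rw [hπC]
    exact Submodule.smul_mem _ _ (Submodule.subset_span ⟨α, rfl⟩)
  have : Module.Finite K V := Module.Finite.of_fg_top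
    (hstair ▸ Submodule.fg_span (Set.finite_range _))
  have hrank : Module.finrank K V ≤ Fintype.card (Fin d → Equiv.Perm (Fin N)) := by
    rw [← card_stair, ← finrank_top K V, ← hstair]
    exact finrank_range_le_card _
  let H : Set (Wave K d N) := {p | (∃ n, p.IsHomogeneous n) ∧
    (p ∈ antisymm K d N ∨ antisymmetrize K d N p = 0)}
  have hH : Submodule.span K (π '' H) = ⊤ := by
    rw [eq_top_iff]
    rintro v -
    obtain ⟨p, rfl⟩ := Ideal.Quotient.mk_surjective v
    change π p ∈ _
    rw [← sum_homogeneousComponent p, map_sum]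
    refine sum_mem fun k _ => ?_
    set q := homogeneousComponent k p
    have hq : q.IsHomogeneous k := homogeneousComponent_isHomogeneous k p
    have he := isHomogeneous_antisymmetrize hq
    -- Splits `q` into its antisymmetric part and a part killed by the antisymmetrizer, both
    -- homogeneous of degree `k`.
    rw [← add_sub_cancel (antisymmetrize K d N q) q, map_add]
    refine add_mem (Submodule.subset_span ⟨_, ⟨⟨k, he⟩, Or.inl (antisymmetrize_mem q)⟩, rfl⟩)
      (Submodule.subset_span ⟨_, ⟨⟨k, hq.sub he⟩, Or.inr ?_⟩, rfl⟩)
    rw [map_sub, antisymmetrize_of_mem (antisymmetrize_mem q), sub_self]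
  obtain ⟨b, hbH, hbspan, hbli⟩ := exists_linearIndependent K (π '' H)
  have : Finite b := hbli.setFinite
  have : Fintype b := Fintype.ofFinite b
  choose f hfH hf using fun v : b => hbH v.2
  have hcard : Fintype.card b ≤ Fintype.card (Fin d → Equiv.Perm (Fin N)) :=
    hbli.fintype_card_le_finrank.trans hrank
  -- Reindexing by `Fin` brings the index type down from the universe of `K` to `Type`.
  let e : Fin (Fintype.card b) ≃ b := (Fintype.equivFin b).symm
  have hspan : Submodule.span (sepSymm K d N) (Set.range (f ∘ e)) = ⊤ := by
    rw [e.surjective.range_comp]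
    choose n hn using fun v : b => (hfH v).1
    refine span_eq_top_of_sub_sum_mem hn fun p => ?_
    have hp : π p ∈ Submodule.span K (Set.range ((↑) : b → V)) := by
      rw [Subtype.range_coe, hbspan, hH]
      exact Submodule.mem_top
    obtain ⟨c, hc⟩ := (Submodule.mem_span_range_iff_exists_fun K).1 hp
    refine ⟨c, ?_⟩
    rw [← hπ, map_sub, map_sum, ← hc, sub_eq_zero]
    exact Finset.sum_congr rfl fun v _ => by rw [hπC, hf]
  exact ⟨Fin (Fintype.card b), inferInstance, f ∘ e,
    linearIndependent_sepSymm hspan (by simpa using hcard), hspan, fun i => (hfH _).1,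
    fun i => (hfH _).2⟩

/-- Antisymmetrizing an expansion in the basis of `R` fixes the members in `A` and kills the others,
so the members in `A` span `A`. -/
theorem exists_isShapeSystem [CharZero K] : ∃ (r : ℕ) (Ψ : Module.Basis (Fin r) (sepSymm K d N)
    (antisymm K d N)), IsShapeSystem Ψ := by
  classical
  obtain ⟨ι, _, h, hli, hspan, hhom, hA⟩ := exists_isHomogeneous_basis (K := K) (d := d) (N := N)
  let I := {i // h i ∈ antisymm K d N}
  let w : I → antisymm K d N := fun i => ⟨h i, i.2⟩
  have hw : LinearIndependent (sepSymm K d N) w :=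
    LinearIndependent.of_comp (antisymm K d N).subtype
      (hli.comp (fun i : I => (i : ι)) Subtype.val_injective)
  have hws : ⊤ ≤ Submodule.span (sepSymm K d N) (Set.range w) := by
    rintro ⟨x, hx⟩ -
    have hx' : x ∈ (Submodule.span (sepSymm K d N) (Set.range w)).map
        (antisymm K d N).subtype := by
      obtain ⟨s, hs⟩ := (Submodule.mem_span_range_iff_exists_fun _).1
        (hspan ▸ Submodule.mem_top : x ∈ Submodule.span (sepSymm K d N) (Set.range h))
      rw [← antisymmetrize_of_mem hx, ← hs, map_sum]
      refine sum_mem fun i _ => ?_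
      rw [map_smul]
      refine Submodule.smul_mem _ _ ?_
      by_cases hi : h i ∈ antisymm K d N
      · rw [antisymmetrize_of_mem hi]
        exact ⟨w ⟨i, hi⟩, Submodule.subset_span ⟨_, rfl⟩, rfl⟩
      · rw [(hA i).resolve_left hi]
        exact zero_mem _
    obtain ⟨y, hy, hyx⟩ := hx'
    have : y = ⟨x, hx⟩ := Subtype.ext hyx
    exact this ▸ hy
  let B := Module.Basis.mk hw hws
  refine ⟨Fintype.card I, B.reindex (Fintype.equivFin I), fun i => ?_⟩
  obtain ⟨n, hn⟩ := hhom ((Fintype.equivFin I).symm i)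
  refine ⟨n, ?_⟩
  rw [Module.Basis.reindex_apply, Module.Basis.mk_apply]
  exact hn

/-! ### Coordinates and exchange in a basis -/

/-- Replace one member of a basis by an element whose coordinate there is a unit. -/
theorem exists_basis_replace {S M ι : Type*} [CommRing S] [AddCommGroup M] [Module S M]
    (Ψ : Module.Basis ι S M) (i : ι) (v : M) (hv : IsUnit (Ψ.repr v i)) :
    ∃ Ψ' : Module.Basis ι S M, Ψ' i = v ∧ ∀ j, j ≠ i → Ψ' j = Ψ j := by
  classical
  obtain ⟨u, hu⟩ := hv
  -- The `i`-th coordinate of `u⁻¹ • v - Ψ i` vanishes, so adding its multiples by the `i`-th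
  -- coordinate is a transvection. It sends `Ψ i` to `u⁻¹ • v` and fixes the other members; scaling
  -- by `u` then gives `v`.
  have h0 : Ψ.coord i (u⁻¹ • v - Ψ i) = 0 := by
    rw [map_sub, Units.smul_def, map_smul, Module.Basis.coord_apply, Module.Basis.coord_apply, ← hu,
      Module.Basis.repr_self, Finsupp.single_eq_same, smul_eq_mul, Units.inv_mul, sub_self]
  refine ⟨(Ψ.map (LinearEquiv.transvection h0)).unitsSMul (fun j => if j = i then u else 1), ?_,
    fun j hj => ?_⟩
  · rw [Module.Basis.unitsSMul_apply, if_pos rfl, Module.Basis.map_apply,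
      LinearEquiv.transvection.apply, Module.Basis.coord_apply, Module.Basis.repr_self,
      Finsupp.single_eq_same, one_smul, add_sub_cancel, smul_inv_smul]
  · rw [Module.Basis.unitsSMul_apply, if_neg hj, Module.Basis.map_apply,
      LinearEquiv.transvection.apply, Module.Basis.coord_apply, Module.Basis.repr_self,
      Finsupp.single_eq_of_ne hj.symm, zero_smul, add_zero, one_smul]

section SubmoduleBasis

variable {S R ι : Type*} [CommRing S] [CommRing R] [Algebra S R] {A : Submodule S R}
  (Ψ : Module.Basis ι S A)

theorem repr_smul_sub_smul {i j : ι} (hij : i ≠ j) (s t : S)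
    (h : s • (Ψ i : R) - t • (Ψ j : R) ∈ A) :
    Ψ.repr ⟨s • (Ψ i : R) - t • (Ψ j : R), h⟩ i = s := by
  have : (⟨s • (Ψ i : R) - t • (Ψ j : R), h⟩ : A) = s • Ψ i - t • Ψ j := rfl
  rw [this]
  simp [Finsupp.single_eq_of_ne hij]

theorem coe_eq_sum_repr (x : A) :
    (x : R) = ∑ j ∈ (Ψ.repr x).support, Ψ.repr x j • (Ψ j : R) := by
  conv_lhs => rw [← Ψ.linearCombination_repr x, Finsupp.linearCombination_apply, Finsupp.sum]
  simp

theorem repr_eq_of_coe_eq_sum [DecidableEq ι] {x : A} {T : Finset ι} {s : ι → S}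
    (h : (x : R) = ∑ j ∈ T, s j • (Ψ j : R)) (i : ι) :
    Ψ.repr x i = if i ∈ T then s i else 0 := by
  have : x = ∑ j ∈ T, s j • Ψ j := Subtype.ext (by simpa using h)
  rw [this, map_sum, Finsupp.finsetSum_apply]
  simp [Finsupp.single_apply]

theorem exists_submodule_basis_replace (i : ι) (v : A) (hv : IsUnit (Ψ.repr v i)) :
    ∃ Ψ' : Module.Basis ι S A, Ψ' i = v ∧ ∀ j, j ≠ i → Ψ' j = Ψ j :=
  exists_basis_replace Ψ i v hv

theorem repr_mem_of_coe_mem_smul {I : Ideal S} {x : A} (hx : (x : R) ∈ I • A) (i : ι) :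
    Ψ.repr x i ∈ I := by
  suffices h : ∃ hy : (x : R) ∈ A, Ψ.repr ⟨x, hy⟩ i ∈ I from h.2
  refine Submodule.smul_induction_on (p := fun y => ∃ hy : y ∈ A, Ψ.repr ⟨y, hy⟩ i ∈ I) hx
    (fun s hs p hp => ⟨Submodule.smul_mem _ s hp, ?_⟩)
    (fun y z ⟨hy, hyi⟩ ⟨hz, hzi⟩ => ⟨add_mem hy hz, ?_⟩)
  · have : Ψ.repr (s • ⟨p, hp⟩) i = s * Ψ.repr ⟨p, hp⟩ i := by
      rw [map_smul, Finsupp.smul_apply, smul_eq_mul]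
    exact this ▸ Ideal.mul_mem_right _ _ hs
  · have : Ψ.repr (⟨y, hy⟩ + ⟨z, hz⟩) i = Ψ.repr ⟨y, hy⟩ i + Ψ.repr ⟨z, hz⟩ i := by
      rw [map_add, Finsupp.add_apply]
    exact this ▸ add_mem hyi hzi

end SubmoduleBasis

/-! ### The highest-graded shape -/

variable {K : Type*} [Field K] {d N : ℕ} {ι : Type*}

theorem repr_mem_sepSymmPos (Ψ : Module.Basis ι (sepSymm K d N) (antisymm K d N))
    {x : antisymm K d N} (hx : (x : Wave K d N) ∈ excitations K d N) (i : ι) :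
    Ψ.repr x i ∈ sepSymmPos K d N :=
  repr_mem_of_coe_mem_smul Ψ hx i

theorem algebraMap_mem_sepSymmPos {c : K} :
    algebraMap K (sepSymm K d N) c ∈ sepSymmPos K d N ↔ c = 0 := by
  rw [mem_sepSymmPos]
  change constantCoeff (C c : Wave K d N) = 0 ↔ c = 0
  simp

/-- Otherwise `Ψ i` would lie in `S₊A`, and its own coordinate 1 would lie in `S₊`. -/
theorem basis_notMem_coinvIdeal [CharZero K]
    (Ψ : Module.Basis ι (sepSymm K d N) (antisymm K d N)) (i : ι) :
    (Ψ i : Wave K d N) ∉ coinvIdeal K d N := by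
  intro h
  have h1 := repr_mem_sepSymmPos Ψ (mem_excitations_iff.2 ⟨h, (Ψ i).2⟩) i
  rw [Module.Basis.repr_self, Finsupp.single_eq_same,
    ← map_one (algebraMap K (sepSymm K d N)), algebraMap_mem_sepSymmPos] at h1
  exact one_ne_zero h1

/-- Two members of a basis are never proportional modulo the coinvariant ideal. -/
theorem basis_eq_of_sub_mem_coinvIdeal [CharZero K]
    (Ψ : Module.Basis ι (sepSymm K d N) (antisymm K d N)) {i j : ι} {b c : K} (hc : c ≠ 0)
    (h : C c * (Ψ i : Wave K d N) - C b * (Ψ j : Wave K d N) ∈ coinvIdeal K d N) : i = j := by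
  by_contra hij
  have hmem := sub_mem ((antisymm K d N).smul_mem (algebraMap K _ c) (Ψ i).2)
    ((antisymm K d N).smul_mem (algebraMap K _ b) (Ψ j).2)
  have h1 := repr_mem_sepSymmPos Ψ (x := ⟨_, hmem⟩) (mem_excitations_iff.2 ⟨h, hmem⟩) i
  rw [repr_smul_sub_smul Ψ hij, algebraMap_mem_sepSymmPos] at h1
  exact hc h1

/-- The coordinates of a homogeneous element in a homogeneous basis are homogeneous. -/
theorem homogeneousComponent_repr (Ψ : Module.Basis ι (sepSymm K d N) (antisymm K d N)) {n : ι → ℕ}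
    (hn : ∀ i, (Ψ i : Wave K d N).IsHomogeneous (n i)) {D : ℕ} (hD : ∀ i, n i ≤ D)
    {x : antisymm K d N} (hx : (x : Wave K d N).IsHomogeneous D) (i : ι) :
    homogeneousComponent (D - n i) (Ψ.repr x i : Wave K d N) = Ψ.repr x i := by
  classical
  -- Taking the degree-`D` component of the expansion of `x` replaces each coordinate by its
  -- component of degree `D - n j`; coordinates are unique.
  let s' : ι → sepSymm K d N := fun j =>
    ⟨_, homogeneousComponent_mem_sepSymm (Ψ.repr x j).2 (D - n j)⟩
  have h2 : (x : Wave K d N) = ∑ j ∈ (Ψ.repr x).support, s' j • (Ψ j : Wave K d N) := by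
    conv_lhs => rw [← homogeneousComponent_eq_self hx, coe_eq_sum_repr Ψ x, map_sum]
    exact Finset.sum_congr rfl fun j _ =>
      homogeneousComponent_mul_of_isHomogeneous (hD j) _ (hn j)
  have h3 := repr_eq_of_coe_eq_sum Ψ h2 i
  by_cases hi : i ∈ (Ψ.repr x).support
  · rw [if_pos hi] at h3
    exact (congrArg Subtype.val h3).symm
  · rw [Finsupp.notMem_support_iff.1 hi]
    exact map_zero _

theorem exists_repr_notMem_sepSymmPos [CharZero K]
    (Ψ : Module.Basis ι (sepSymm K d N) (antisymm K d N)) {x : antisymm K d N}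
    (hx : (x : Wave K d N) ∉ coinvIdeal K d N) : ∃ i, Ψ.repr x i ∉ sepSymmPos K d N := by
  by_contra! h
  refine hx ?_
  rw [coe_eq_sum_repr Ψ x]
  exact sum_mem fun j _ => mul_mem_coinvIdeal (h j) _

theorem isShapeSystem_top {K : Type*} [Field K] [CharZero K] {d N : ℕ} (hd : Odd d)
    {ι : Type*} (Ψ : Module.Basis ι (sepSymm K d N) (antisymm K d N)) (hΨ : IsShapeSystem Ψ) :
    ∃ i : ι, (Ψ i : Wave K d N).IsHomogeneous (d * N * (N - 1) / 2) ∧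
      (∀ j : ι, j ≠ i → (Ψ j : Wave K d N).totalDegree < d * N * (N - 1) / 2) ∧
      (∃ c : K, c ≠ 0 ∧ (Ψ i : Wave K d N) - C c * vandermondeProd K d N ∈ excitations K d N) ∧
      ∃ Ψ' : Module.Basis ι (sepSymm K d N) (antisymm K d N), IsShapeSystem Ψ' ∧
        (Ψ' i : Wave K d N) = vandermondeProd K d N ∧ ∀ j : ι, j ≠ i → Ψ' j = Ψ j := by
  choose n hn using hΨ
  set D := d * N * (N - 1) / 2 with hD
  have hle : ∀ i, n i ≤ D := fun i => by
    by_contra! hlt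
    exact basis_notMem_coinvIdeal Ψ i (mem_coinvIdeal_of_isHomogeneous (hn i) hlt)
  have hc : ∀ i, n i = D → ∃ c : K, c ≠ 0 ∧
      (Ψ i : Wave K d N) - C c * vandermondeProd K d N ∈ coinvIdeal K d N := by
    intro i hi
    obtain ⟨c, hc⟩ := exists_sub_C_mul_vandermondeProd_mem (hi ▸ hn i :
      (Ψ i : Wave K d N).IsHomogeneous D)
    refine ⟨c, ?_, hc⟩
    rintro rfl
    rw [C_0, zero_mul, sub_zero] at hc
    exact basis_notMem_coinvIdeal Ψ i hc
  have huniq : ∀ i j, n i = D → n j = D → i = j := by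
    intro i j hi hj
    obtain ⟨b, -, hb⟩ := hc i hi
    obtain ⟨c, hc0, hc⟩ := hc j hj
    refine basis_eq_of_sub_mem_coinvIdeal Ψ (b := b) hc0 ?_
    convert sub_mem (Ideal.mul_mem_left _ (C c) hb) (Ideal.mul_mem_left _ (C b) hc) using 1
    ring
  let Δ : antisymm K d N := ⟨vandermondeProd K d N, vandermondeProd_mem_antisymm hd⟩
  obtain ⟨i, hi⟩ := exists_repr_notMem_sepSymmPos Ψ (x := Δ) vandermondeProd_notMem_coinvIdeal
  have hcomp := homogeneousComponent_repr Ψ hn hle (x := Δ) isHomogeneous_vandermondeProd i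
  rw [mem_sepSymmPos] at hi
  -- Were `n i < D`, the coordinate would be homogeneous of positive degree and have zero constant
  -- term.
  have hni : n i = D := by
    by_contra hne
    have := hle i
    rw [← hcomp, constantCoeff_eq, coeff_homogeneousComponent, map_zero, if_neg (by omega)] at hi
    exact hi rfl
  have hunit : IsUnit (Ψ.repr Δ i) := by
    rw [hni, Nat.sub_self, homogeneousComponent_zero] at hcomp
    have h1 : Ψ.repr Δ i = algebraMap K (sepSymm K d N) (coeff 0 (Ψ.repr Δ i : Wave K d N)) :=
      Subtype.ext hcomp.symm
    rw [h1]
    exact (IsUnit.mk0 _ hi).map _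
  obtain ⟨c, hc0, hcmem⟩ := hc i hni
  obtain ⟨Ψ', hΨ'i, hΨ'⟩ := exists_submodule_basis_replace Ψ i Δ hunit
  refine ⟨i, hni ▸ hn i, fun j hj => ?_, ⟨c, hc0, mem_excitations_iff.2 ⟨hcmem, ?_⟩⟩, Ψ', ?_, ?_,
    hΨ'⟩
  · exact (hn j).totalDegree_le.trans_lt
      (lt_of_le_of_ne (hle j) fun h => hj (huniq j i h hni))
  · exact sub_mem (Ψ i).2 ((antisymm K d N).smul_mem (algebraMap K (sepSymm K d N) c) Δ.2)
  · intro j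
    by_cases hj : j = i
    · rw [hj, hΨ'i]
      exact ⟨D, isHomogeneous_vandermondeProd⟩
    · rw [hΨ' j hj]
      exact ⟨n j, hn j⟩
  · rw [hΨ'i]

end FermionShapes

theorem proposition3 {K : Type*} [Field K] [CharZero K] (d N : ℕ) (hd : Odd d) :
    (∃ (r : ℕ) (Ψ : Module.Basis (Fin r) (FermionShapes.sepSymm K d N)
        (FermionShapes.antisymm K d N)), FermionShapes.IsShapeSystem Ψ) ∧
    ∀ {ι : Type*} (Ψ : Module.Basis ι (FermionShapes.sepSymm K d N)
        (FermionShapes.antisymm K d N)), FermionShapes.IsShapeSystem Ψ →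
      ∃ i : ι,
        (Ψ i : FermionShapes.Wave K d N).IsHomogeneous (d * N * (N - 1) / 2) ∧
        (∀ j : ι, j ≠ i →
          (Ψ j : FermionShapes.Wave K d N).totalDegree < d * N * (N - 1) / 2) ∧
        (∃ c : K, c ≠ 0 ∧
          (Ψ i : FermionShapes.Wave K d N) - C c * FermionShapes.vandermondeProd K d N
            ∈ FermionShapes.excitations K d N) ∧
        ∃ Ψ' : Module.Basis ι (FermionShapes.sepSymm K d N) (FermionShapes.antisymm K d N),
          FermionShapes.IsShapeSystem Ψ' ∧
          (Ψ' i : FermionShapes.Wave K d N) = FermionShapes.vandermondeProd K d N ∧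
          ∀ j : ι, j ≠ i → Ψ' j = Ψ j :=
  ⟨FermionShapes.exists_isShapeSystem, fun Ψ hΨ => FermionShapes.isShapeSystem_top hd Ψ hΨ⟩
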